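/- **Theorem.** Let $M$ be any model of $\mathsf{RCA}_0$, i.e. any (possibly nonstandard) structure for the language of second-order arithmetic, with numbers $\mathbb N$ and a collection of sets of numbers, that satisfies the basic axioms of arithmetic, $\Sigma^0_1$-induction and $\Delta^0_1$-comprehension (both schemes with parameters); let $k$ be any number of $M$. All notions below are read in $M$: relations, colourings, functions and infinite sequences are (coded by) sets of $M$, finite sequences are coded by numbers of $M$, and "$k$ relations $R_0,\dots,R_{k-1}$" means a sequence $(R_i)_{i<k}$ coded by one set of $M$. A binary relation $R$ on $\mathbb N$ is *well-founded* if there is no $f:\mathbb N\to\mathbb N$ with $f(n+1)\,R\,f(n)$ for all $n$; $R^+$ is its transitive closure. $H(R)$ is the set of finite sequences $\langle x_0,\dots,x_{n-1}\rangle$ such that $x_j\,R\,x_i$ whenever $i<j<n$, and $R$ is *$H$-well-founded* if there is no infinite sequence $s_0,s_1,\dots$ of elements of $H(R)$ in which each $s_{n+1}$ extends $s_n$ by exactly one entry. Then the following are equivalent. 1. (Termination Theorem for $k$ relations.) For every binary relation $R$ on $\mathbb N$: if there are $k$ well-founded relations $R_0,\dots,R_{k-1}$ with $R^+\subseteq R_0\cup\dots\cup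 R_{k-1}$, then $R$ is well-founded. 2. ($\mathsf{WRT}^2_k$, Weak Ramsey's Theorem.) For every $P:[\mathbb N]^2\to k$ there are $c<k$ and an infinite set $H=\{x_0<x_1<x_2<\cdots\}\subseteq\mathbb N$ such that $P(\{x_i,x_{i+1}\})=c$ for every $i$. 3. (Weak $H$-closure Theorem for $k$ relations.) For any well-founded relations $R_0,\dots,R_{k-1}$, the union $R_0\cup\dots\cup R_{k-1}$ is $H$-well-founded. By Gödel's completeness theorem this says that $\mathsf{RCA}_0$ proves: for every number $k$, the statements 1, 2 and 3 are equivalent. -/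

import Mathlib

universe u

/-- A structure for the language of second-order arithmetic (Henkin semantics): a first-order part
`Num` with `0, 1, +, ·, <`, and a collection `sets` of subsets of `Num`, over which the set
variables range. Neither part has to be standard. -/
structure L2Structure where
  Num : Type u
  zero : Num
  one : Num
  add : Num → Num → Num
  mul : Num → Num → Num
  lt : Num → Num → Prop
  sets : Set (Set Num)

namespace L2Structure

instance (M : L2Structure.{u}) : Zero M.Num := ⟨M.zero⟩
instance (M : L2Structure.{u}) : One M.Num := ⟨M.one⟩
instance (M : L2Structure.{u}) : Add M.Num := ⟨M.add⟩
instance (M : L2Structure.{u}) : Mul M.Num := ⟨M.mul⟩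
instance (M : L2Structure.{u}) : LT M.Num := ⟨M.lt⟩

/-! ### Bounded-quantifier formulas with parameters -/

/-- Numerical terms with parameters from `M` and with `n` free number variables. -/
inductive NumTerm (M : L2Structure.{u}) (n : ℕ) : Type u
  | var : Fin n → NumTerm M n
  | param : M.Num → NumTerm M n
  | zero : NumTerm M n
  | one : NumTerm M n
  | add : NumTerm M n → NumTerm M n → NumTerm M n
  | mul : NumTerm M n → NumTerm M n → NumTerm M n

/-- The value of a term under an assignment of its variables. -/
def NumTerm.eval {M : L2Structure.{u}} {n : ℕ} (v : Fin n → M.Num) : NumTerm M n → M.Num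
  | .var i => v i
  | .param a => a
  | .zero => 0
  | .one => 1
  | .add s t => s.eval v + t.eval v
  | .mul s t => s.eval v * t.eval v

/-- Bounded-quantifier (`Δ⁰₀`) formulas of second-order arithmetic, with number and set parameters
from `M` and with `n` free number variables. In `ball t φ` (for all `x < t`, `φ`) and `bex t φ`
(for some `x < t`, `φ`) the bound variable is variable `0` of `φ`; it does not occur in `t`. -/
inductive BFormula (M : L2Structure.{u}) : ℕ → Type u
  | eq {n : ℕ} : NumTerm M n → NumTerm M n → BFormula M n
  | lt {n : ℕ} : NumTerm M n → NumTerm M n → BFormula M n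
  | mem {n : ℕ} : NumTerm M n → M.sets → BFormula M n
  | not {n : ℕ} : BFormula M n → BFormula M n
  | and {n : ℕ} : BFormula M n → BFormula M n → BFormula M n
  | or {n : ℕ} : BFormula M n → BFormula M n → BFormula M n
  | imp {n : ℕ} : BFormula M n → BFormula M n → BFormula M n
  | ball {n : ℕ} : NumTerm M n → BFormula M (n + 1) → BFormula M n
  | bex {n : ℕ} : NumTerm M n → BFormula M (n + 1) → BFormula M n

/-- Truth of a bounded-quantifier formula in `M`. -/
def BFormula.Realize {M : L2Structure.{u}} : {n : ℕ} → BFormula M n → (Fin n → M.Num) → Prop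
  | _, .eq s t, v => s.eval v = t.eval v
  | _, .lt s t, v => s.eval v < t.eval v
  | _, .mem t X, v => t.eval v ∈ X.1
  | _, .not φ, v => ¬ φ.Realize v
  | _, .and φ ψ, v => φ.Realize v ∧ ψ.Realize v
  | _, .or φ ψ, v => φ.Realize v ∨ ψ.Realize v
  | _, .imp φ ψ, v => φ.Realize v → ψ.Realize v
  | _, .ball t φ, v => ∀ x : M.Num, x < t.eval v → φ.Realize (Matrix.vecCons x v)
  | _, .bex t φ, v => ∃ x : M.Num, x < t.eval v ∧ φ.Realize (Matrix.vecCons x v)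

variable (M : L2Structure.{u})

/-- `p` is defined in `M` by a `Σ⁰₁` formula `∃ m, θ(m, n)` with parameters. -/
def IsSigma01 (p : M.Num → Prop) : Prop :=
  ∃ θ : BFormula M 2, ∀ n : M.Num, p n ↔ ∃ m : M.Num, θ.Realize ![m, n]

/-- `p` is defined in `M` by a `Π⁰₁` formula `∀ m, θ(m, n)` with parameters. -/
def IsPi01 (p : M.Num → Prop) : Prop :=
  ∃ θ : BFormula M 2, ∀ n : M.Num, p n ↔ ∀ m : M.Num, θ.Realize ![m, n]

/-- `M` is a model of `RCA₀`: the basic axioms of arithmetic, induction for `Σ⁰₁` formulas and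
comprehension for `Δ⁰₁` formulas (number and set parameters are allowed in both schemes). -/
structure IsModelRCA0 : Prop where
  succ_ne_zero : ∀ n : M.Num, n + 1 ≠ 0
  succ_inj : ∀ m n : M.Num, m + 1 = n + 1 → m = n
  add_zero : ∀ m : M.Num, m + 0 = m
  add_succ : ∀ m n : M.Num, m + (n + 1) = (m + n) + 1
  mul_zero : ∀ m : M.Num, m * 0 = 0
  mul_succ : ∀ m n : M.Num, m * (n + 1) = m * n + m
  not_lt_zero : ∀ m : M.Num, ¬ m < 0
  lt_succ_iff : ∀ m n : M.Num, m < n + 1 ↔ m < n ∨ m = n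
  sigma01_induction : ∀ p : M.Num → Prop, M.IsSigma01 p →
    p 0 → (∀ n, p n → p (n + 1)) → ∀ n, p n
  delta01_comprehension : ∀ p : M.Num → Prop, M.IsSigma01 p → M.IsPi01 p →
    {n : M.Num | p n} ∈ M.sets

/-! ### Coding inside `M`

All quantifiers below range over the numbers and the sets of `M`. -/

variable {M}

/-- The code `(a + b)² + a` of the ordered pair `(a, b)`. -/
def pair (a b : M.Num) : M.Num := (a + b) * (a + b) + a

/-- `F` is (the graph of) a function from the numbers to the numbers, and it is a set of `M`. -/
def IsFun (F : Set M.Num) : Prop :=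
  F ∈ M.sets ∧ ∀ n : M.Num, ∃! a : M.Num, pair n a ∈ F

/-- The set `X` is infinite, that is, unbounded. -/
def IsInfinite (X : Set M.Num) : Prop :=
  ∀ n : M.Num, ∃ a : M.Num, n < a ∧ a ∈ X

/-- `x` belongs to the finite set with code `c = (b, (d, e))`, which consists of the numbers
`x < b` such that `d (x + 1) + 1` divides `e`. -/
def CodedMem (x c : M.Num) : Prop :=
  ∃ b d e : M.Num, c = pair b (pair d e) ∧ x < b ∧ ∃ q : M.Num, e = q * (d * (x + 1) + 1)

/-- The value at place `i` of the finite sequence with code `s` is `a`. -/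
def SeqVal (s i a : M.Num) : Prop := CodedMem (pair i a) s

/-- `s` is a code of a finite sequence of length `l`: the finite set coded by `s` is (the graph of)
a function with domain `{i : i < l}`. (A sequence may have several codes.) -/
def IsSeq (s l : M.Num) : Prop :=
  (∀ z : M.Num, CodedMem z s → ∃ i a : M.Num, i < l ∧ z = pair i a) ∧
    ∀ i : M.Num, i < l → ∃! a : M.Num, SeqVal s i a

/-! ### Relations, transitive closure, well-foundedness -/

/-- The binary relation on the numbers that is coded by the set `X`. -/
def Rel (X : Set M.Num) (x y : M.Num) : Prop := pair x y ∈ X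

/-- The `i`-th relation of the sequence of binary relations that is coded by the set `X`. -/
def RelAt (X : Set M.Num) (i x y : M.Num) : Prop := pair i (pair x y) ∈ X

/-- The union of the relations `RelAt X i`, `i < k`. -/
def UnionRel (X : Set M.Num) (k x y : M.Num) : Prop := ∃ i : M.Num, i < k ∧ RelAt X i x y

/-- The transitive closure of `R`: there is a finite sequence of length `l + 1 ≥ 2` from `x` to `y`,
each of whose entries is `R`-related to the next one. -/
def TransClosure (R : M.Num → M.Num → Prop) (x y : M.Num) : Prop :=
  ∃ s l : M.Num, 0 < l ∧ IsSeq s (l + 1) ∧ SeqVal s 0 x ∧ SeqVal s l y ∧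
    ∀ i a b : M.Num, i < l → SeqVal s i a → SeqVal s (i + 1) b → R a b

/-- `R` is well-founded (in `M`): no function `f` of `M` satisfies `f(n + 1) R f(n)` for all `n`. -/
def WF (R : M.Num → M.Num → Prop) : Prop :=
  ¬ ∃ F : Set M.Num, IsFun F ∧
    ∀ n a b : M.Num, pair n a ∈ F → pair (n + 1) b ∈ F → R b a

/-- `s ∈ H(R)`: `s` codes a finite transitive `R`-decreasing sequence, that is, `s(j) R s(i)`
whenever `i < j < lh(s)`. -/
def InH (R : M.Num → M.Num → Prop) (s : M.Num) : Prop :=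
  ∃ l : M.Num, IsSeq s l ∧
    ∀ i j a b : M.Num, i < j → j < l → SeqVal s i a → SeqVal s j b → R b a

/-- One-step expansion `t ≻ s` of finite sequences. -/
def OneStepExt (t s : M.Num) : Prop :=
  ∃ l : M.Num, IsSeq s l ∧ IsSeq t (l + 1) ∧
    ∀ i a : M.Num, i < l → (SeqVal t i a ↔ SeqVal s i a)

/-- `R` is `H`-well-founded: the relation `≻` on `H(R)` is well-founded. -/
def HWF (R : M.Num → M.Num → Prop) : Prop :=
  WF (fun t s : M.Num => InH R t ∧ InH R s ∧ OneStepExt t s)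

/-- `P` is a colouring `[ℕ]² → k` in `M`; the unordered pair `{m, n}` with `m < n` is represented
by `(m, n)`, and `((m, n), c) ∈ P` says that its colour is `c`. -/
def IsColoring (P : Set M.Num) (k : M.Num) : Prop :=
  P ∈ M.sets ∧ ∀ m n : M.Num, m < n →
    (∃! c : M.Num, pair (pair m n) c ∈ P) ∧ ∀ c : M.Num, pair (pair m n) c ∈ P → c < k

variable (M)

/-! ### The three principles, for a number `k` of `M` -/

/-- The Termination Theorem for `k` relations: if the union of `k` well-founded relations contains
the transitive closure of `R`, then `R` is well-founded. -/
def TerminationTheorem (k : M.Num) : Prop :=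
  ∀ R ∈ M.sets, ∀ X ∈ M.sets,
    (∀ i : M.Num, i < k → WF (RelAt X i)) →
    (∀ x y : M.Num, TransClosure (Rel R) x y → UnionRel X k x y) →
    WF (Rel R)

/-- `WRT²_k`: for every colouring `P : [ℕ]² → k` there are a colour `c < k` and an infinite set
`H = {x₀ < x₁ < ⋯}` such that every pair `{x_i, x_{i+1}}` has colour `c`. -/
def WRT (k : M.Num) : Prop :=
  ∀ P : Set M.Num, IsColoring P k →
    ∃ c : M.Num, c < k ∧ ∃ H ∈ M.sets, IsInfinite H ∧ ∃ F : Set M.Num, IsFun F ∧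
      (∀ a : M.Num, a ∈ H ↔ ∃ i : M.Num, pair i a ∈ F) ∧
      ∀ i a b : M.Num, pair i a ∈ F → pair (i + 1) b ∈ F → a < b ∧ pair (pair a b) c ∈ P

/-- Weak `H`-closure for `k` relations: the union of `k` well-founded relations is
`H`-well-founded. -/
def WeakHClosure (k : M.Num) : Prop :=
  ∀ X ∈ M.sets, (∀ i : M.Num, i < k → WF (RelAt X i)) → HWF (UnionRel X k)

end L2Structure

/-!
The three principles are equivalent through a cycle, and the proof works inside an arbitrary model
of `RCA₀`, whose numbers may be nonstandard.

* Termination gives `WRT` (`wrt_of_terminationTheorem`). For a colouring `P` let `y X_c x` mean that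
  `x < y` and `P(x, y) = c`, and let `R` relate `n + 1` to `n`. The transitive closure of `R` is
  `>`, which is the union of the `X_c`, and `R` is not well-founded. So some `X_c` has a descending
  sequence, and its range is weakly homogeneous of colour `c`.
* `WRT` gives weak `H`-closure (`weakHClosure_of_wrt`). An infinite chain of one-step extensions in
  `H(⋃ X_c)` has a union `g` with `g j (⋃ X_c) g i` for all `i < j`. Colour `(i, j)` with the least
  `c` such that `g j X_c g i`; along a weakly homogeneous set of colour `c`, the values of `g` descend
  for `X_c`.
* Weak `H`-closure gives termination (`terminationTheorem_of_weakHClosure`). The initial segments of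
  an `R`-descending `f` lie in `H(⋃ X_c)`, because the reversed segment `f j, …, f i` shows that
  `(f j, f i)` is in the transitive closure of `R`.

Sets and inductions are restricted to definable predicates. Definability is tracked by the classes
`IsTerm` and `IsDelta0`, whose closure properties are instances; every `Σ⁰₁` induction and every
comprehension in the proof then only asks for a `Δ⁰₀` matrix. From the basic axioms and induction the
numbers of the model become an ordered commutative semiring, so that Mathlib's lemmas and `ring`
apply. Finite sequences are obtained from `exists_code`: if `d` is a multiple of `1, …, b`, the
moduli `d (x + 1) + 1` for `x < b` are pairwise coprime, and a `Σ⁰₁` induction multiplies together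
those that belong to the given set.
-/

namespace L2Structure

variable {M : L2Structure.{u}} {n m : ℕ}

/-! ### Definability -/

/-- `f` is the value of a numerical term with parameters. -/
class IsTerm (f : (Fin n → M.Num) → M.Num) : Prop where
  exists_term : ∃ t : NumTerm M n, ∀ v, t.eval v = f v

/-- `p` is defined by a bounded-quantifier formula with parameters. This is a class, so that
definability of an explicit predicate is found by instance search. -/
class IsDelta0 (p : (Fin n → M.Num) → Prop) : Prop where
  exists_formula : ∃ φ : BFormula M n, ∀ v, φ.Realize v ↔ p v

namespace IsTerm

instance var (i : Fin n) : IsTerm (M := M) (fun v => v i) := ⟨.var i, fun _ => rfl⟩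

instance const (a : M.Num) : IsTerm (M := M) (n := n) (fun _ => a) := ⟨.param a, fun _ => rfl⟩

instance add (f g : (Fin n → M.Num) → M.Num) [hf : IsTerm f] [hg : IsTerm g] :
    IsTerm (fun v => f v + g v) := by
  obtain ⟨s, hs⟩ := hf
  obtain ⟨t, ht⟩ := hg
  exact ⟨.add s t, fun v => by simp [NumTerm.eval, hs, ht]⟩

instance mul (f g : (Fin n → M.Num) → M.Num) [hf : IsTerm f] [hg : IsTerm g] :
    IsTerm (fun v => f v * g v) := by
  obtain ⟨s, hs⟩ := hf
  obtain ⟨t, ht⟩ := hg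
  exact ⟨.mul s t, fun v => by simp [NumTerm.eval, hs, ht]⟩

instance pair (f g : (Fin n → M.Num) → M.Num) [IsTerm f] [IsTerm g] :
    IsTerm (fun v => pair (f v) (g v)) := by
  unfold L2Structure.pair
  infer_instance

theorem comp {f : (Fin m → M.Num) → M.Num} (hf : IsTerm f) (g : Fin m → (Fin n → M.Num) → M.Num)
    (hg : ∀ i, IsTerm (g i)) : IsTerm (fun v => f fun i => g i v) := by
  obtain ⟨t, ht⟩ := hf
  simp only [← ht]
  clear ht
  induction t with
  | var i => exact hg i
  | param a => exact const a
  | zero => exact const 0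
  | one => exact const 1
  | add s t hs ht => exact add _ _
  | mul s t hs ht => exact mul _ _

end IsTerm

namespace IsDelta0

theorem congr {p q : (Fin n → M.Num) → Prop} (hp : IsDelta0 p) (h : ∀ v, p v ↔ q v) :
    IsDelta0 q := by
  rwa [← funext fun v => propext (h v)]

instance eq (f g : (Fin n → M.Num) → M.Num) [hf : IsTerm f] [hg : IsTerm g] :
    IsDelta0 (fun v => f v = g v) := by
  obtain ⟨s, hs⟩ := hf
  obtain ⟨t, ht⟩ := hg
  exact ⟨.eq s t, fun v => by simp [BFormula.Realize, hs, ht]⟩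

instance lt (f g : (Fin n → M.Num) → M.Num) [hf : IsTerm f] [hg : IsTerm g] :
    IsDelta0 (fun v => f v < g v) := by
  obtain ⟨s, hs⟩ := hf
  obtain ⟨t, ht⟩ := hg
  exact ⟨.lt s t, fun v => by simp [BFormula.Realize, hs, ht]⟩

instance mem (f : (Fin n → M.Num) → M.Num) (X : Set M.Num) [hX : Fact (X ∈ M.sets)]
    [hf : IsTerm f] : IsDelta0 (fun v => f v ∈ X) := by
  obtain ⟨s, hs⟩ := hf
  exact ⟨.mem s ⟨X, hX.out⟩, fun v => by simp [BFormula.Realize, hs]⟩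

instance not (p : (Fin n → M.Num) → Prop) [hp : IsDelta0 p] : IsDelta0 (fun v => ¬ p v) := by
  obtain ⟨φ, hφ⟩ := hp
  exact ⟨.not φ, fun v => by simp [BFormula.Realize, hφ]⟩

instance and (p q : (Fin n → M.Num) → Prop) [hp : IsDelta0 p] [hq : IsDelta0 q] :
    IsDelta0 (fun v => p v ∧ q v) := by
  obtain ⟨φ, hφ⟩ := hp
  obtain ⟨ψ, hψ⟩ := hq
  exact ⟨.and φ ψ, fun v => by simp [BFormula.Realize, hφ, hψ]⟩

instance or (p q : (Fin n → M.Num) → Prop) [hp : IsDelta0 p] [hq : IsDelta0 q] :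
    IsDelta0 (fun v => p v ∨ q v) := by
  obtain ⟨φ, hφ⟩ := hp
  obtain ⟨ψ, hψ⟩ := hq
  exact ⟨.or φ ψ, fun v => by simp [BFormula.Realize, hφ, hψ]⟩

instance imp (p q : (Fin n → M.Num) → Prop) [hp : IsDelta0 p] [hq : IsDelta0 q] :
    IsDelta0 (fun v => p v → q v) := by
  obtain ⟨φ, hφ⟩ := hp
  obtain ⟨ψ, hψ⟩ := hq
  exact ⟨.imp φ ψ, fun v => by simp [BFormula.Realize, hφ, hψ]⟩

instance iff (p q : (Fin n → M.Num) → Prop) [IsDelta0 p] [IsDelta0 q] :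
    IsDelta0 (fun v => p v ↔ q v) := by
  simp only [iff_iff_implies_and_implies]
  infer_instance

instance ball (f : (Fin n → M.Num) → M.Num) (p : (Fin n → M.Num) → M.Num → Prop)
    [hf : IsTerm f]
    [hp : IsDelta0 (fun w : Fin (n + 1) → M.Num => p (fun i => w i.succ) (w 0))] :
    IsDelta0 (fun v => ∀ x, x < f v → p v x) := by
  obtain ⟨t, ht⟩ := hf
  obtain ⟨φ, hφ⟩ := hp
  exact ⟨.ball t φ, fun v => by simp [BFormula.Realize, hφ, ht]⟩

instance bex (f : (Fin n → M.Num) → M.Num) (p : (Fin n → M.Num) → M.Num → Prop)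
    [hf : IsTerm f]
    [hp : IsDelta0 (fun w : Fin (n + 1) → M.Num => p (fun i => w i.succ) (w 0))] :
    IsDelta0 (fun v => ∃ x, x < f v ∧ p v x) := by
  obtain ⟨t, ht⟩ := hf
  obtain ⟨φ, hφ⟩ := hp
  exact ⟨.bex t φ, fun v => by simp [BFormula.Realize, hφ, ht]⟩

/-- Substitution of terms into a bounded-quantifier formula. -/
theorem comp {p : (Fin m → M.Num) → Prop} (hp : IsDelta0 p)
    (g : Fin m → (Fin n → M.Num) → M.Num) (hg : ∀ i, IsTerm (g i)) :
    IsDelta0 (fun v => p fun i => g i v) := by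
  obtain ⟨φ, hφ⟩ := hp
  simp only [← hφ]
  clear hφ p
  -- under a bounded quantifier, the bound variable is substituted for itself
  have cons_eq {m n : ℕ} (g : Fin m → (Fin n → M.Num) → M.Num) (w : Fin (n + 1) → M.Num) :
      (fun i => (Fin.cases (fun w => w 0) (fun j w => g j fun i => w i.succ) i :
        (Fin (n + 1) → M.Num) → M.Num) w) =
        Matrix.vecCons (w 0) (fun j => g j fun i => w i.succ) := by
    funext i
    cases i using Fin.cases <;> rfl
  have cons_term {m n : ℕ} (g : Fin m → (Fin n → M.Num) → M.Num) (hg : ∀ i, IsTerm (g i))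
      (i : Fin (m + 1)) :
      IsTerm (Fin.cases (fun w => w 0) (fun j w => g j fun i => w i.succ) i :
        (Fin (n + 1) → M.Num) → M.Num) := by
    cases i using Fin.cases with
    | zero => exact IsTerm.var 0
    | succ j => exact (hg j).comp _ fun i => IsTerm.var i.succ
  have hterm {m n : ℕ} (t : NumTerm M m) (g : Fin m → (Fin n → M.Num) → M.Num)
      (hg : ∀ i, IsTerm (g i)) : IsTerm (fun v => t.eval fun i => g i v) :=
    IsTerm.comp ⟨t, fun _ => rfl⟩ g hg
  induction φ generalizing n with
  | eq s t =>
    have := hterm s g hg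
    have := hterm t g hg
    exact eq _ _
  | lt s t =>
    have := hterm s g hg
    have := hterm t g hg
    exact lt _ _
  | mem t X =>
    have := hterm t g hg
    have : Fact (X.1 ∈ M.sets) := ⟨X.2⟩
    exact mem _ _
  | not φ h =>
    have := h g hg
    exact not _
  | and φ ψ h h' =>
    have := h g hg
    have := h' g hg
    exact and _ _
  | or φ ψ h h' =>
    have := h g hg
    have := h' g hg
    exact or _ _
  | imp φ ψ h h' =>
    have := h g hg
    have := h' g hg
    exact imp _ _
  | ball t φ h =>
    have := hterm t g hg
    have := h _ (cons_term g hg)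
    simp only [cons_eq] at this
    exact ball _ fun v x => φ.Realize (Matrix.vecCons x fun i => g i v)
  | bex t φ h =>
    have := hterm t g hg
    have := h _ (cons_term g hg)
    simp only [cons_eq] at this
    exact bex _ fun v x => φ.Realize (Matrix.vecCons x fun i => g i v)

theorem comp₁ {p : M.Num → Prop} (hp : IsDelta0 fun v : Fin 1 → M.Num => p (v 0))
    (f : (Fin n → M.Num) → M.Num) [hf : IsTerm f] : IsDelta0 fun v => p (f v) :=
  hp.comp (fun _ => f) fun _ => hf

theorem comp₂ {p : M.Num → M.Num → Prop} (hp : IsDelta0 fun v : Fin 2 → M.Num => p (v 0) (v 1))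
    (f g : (Fin n → M.Num) → M.Num) [hf : IsTerm f] [hg : IsTerm g] :
    IsDelta0 fun v => p (f v) (g v) :=
  hp.comp ![f, g] (Fin.forall_fin_two.2 ⟨hf, hg⟩)

theorem comp₃ {p : M.Num → M.Num → M.Num → Prop}
    (hp : IsDelta0 fun v : Fin 3 → M.Num => p (v 0) (v 1) (v 2))
    (f g h : (Fin n → M.Num) → M.Num) [hf : IsTerm f] [hg : IsTerm g] [hh : IsTerm h] :
    IsDelta0 fun v => p (f v) (g v) (h v) :=
  hp.comp ![f, g, h] (Fin.forall_fin_succ.2 ⟨hf, Fin.forall_fin_two.2 ⟨hg, hh⟩⟩)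

end IsDelta0

theorem isSigma01_of_isDelta0 (p : M.Num → M.Num → Prop)
    [h : IsDelta0 (fun v : Fin 2 → M.Num => p (v 0) (v 1))] :
    M.IsSigma01 fun n => ∃ m, p m n := by
  obtain ⟨φ, hφ⟩ := h
  exact ⟨φ, fun n => by simp [hφ]⟩

/-- A set of `M` that is a function is the graph of an external function on the numbers of `M`. -/
theorem IsFun.exists_eq {F : Set M.Num} (hF : IsFun F) :
    ∃ f : M.Num → M.Num, ∀ n a, pair n a ∈ F ↔ a = f n := by
  choose f hf hf' using hF.2
  exact ⟨f, fun n a => ⟨hf' n a, by rintro rfl; exact hf n⟩⟩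

/-! ### Arithmetic -/

/-! The hypothesis on `M` is a `Fact`, so that the algebraic structure of `M.Num` can be given by
instances. -/

variable [hM : Fact M.IsModelRCA0]

/-- Induction for `Σ⁰₁` predicates, given by their `Δ⁰₀` matrix. -/
theorem exists_induction (p : M.Num → M.Num → Prop)
    [IsDelta0 (fun v : Fin 2 → M.Num => p (v 0) (v 1))] (zero : ∃ m, p m 0)
    (succ : ∀ n, (∃ m, p m n) → ∃ m, p m (n + 1)) (n : M.Num) : ∃ m, p m n :=
  hM.out.sigma01_induction _ (isSigma01_of_isDelta0 p) zero succ n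

theorem delta0_induction (p : M.Num → Prop) [h : IsDelta0 (fun v : Fin 1 → M.Num => p (v 0))]
    (zero : p 0) (succ : ∀ n, p n → p (n + 1)) (n : M.Num) : p n := by
  have : IsDelta0 (fun v : Fin 2 → M.Num => p (v 1)) := h.comp₁ _
  obtain ⟨_, h⟩ := exists_induction (fun _ => p) ⟨0, zero⟩ (fun n ⟨_, h⟩ => ⟨0, succ n h⟩) n
  exact h

namespace Arith

variable (a b c : M.Num)

theorem zero_add : 0 + a = a := by
  refine delta0_induction (fun a : M.Num => 0 + a = a) (hM.out.add_zero 0) (fun n h => ?_) a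
  rw [hM.out.add_succ, h]

theorem add_assoc : a + b + c = a + (b + c) := by
  refine delta0_induction (fun c => a + b + c = a + (b + c)) ?_ (fun n h => ?_) c
  · rw [hM.out.add_zero, hM.out.add_zero]
  · rw [hM.out.add_succ, hM.out.add_succ, hM.out.add_succ, h]

theorem one_add : 1 + a = a + 1 := by
  refine delta0_induction (fun a : M.Num => 1 + a = a + 1) ?_ (fun n h => ?_) a
  · rw [hM.out.add_zero, zero_add]
  · rw [hM.out.add_succ, h]

theorem add_comm : a + b = b + a := by
  refine delta0_induction (fun b => a + b = b + a) ?_ (fun n h => ?_) b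
  · rw [hM.out.add_zero, zero_add]
  · rw [hM.out.add_succ, h, add_assoc, ← one_add a, add_assoc]

theorem zero_mul : 0 * a = 0 := by
  refine delta0_induction (fun a : M.Num => 0 * a = 0) (hM.out.mul_zero 0) (fun n h => ?_) a
  rw [hM.out.mul_succ, h, hM.out.add_zero]

theorem mul_one : a * 1 = a := by
  rw [← zero_add (1 : M.Num), hM.out.mul_succ, hM.out.mul_zero, zero_add]

theorem mul_add : a * (b + c) = a * b + a * c := by
  refine delta0_induction (fun c => a * (b + c) = a * b + a * c) ?_ (fun n h => ?_) c
  · rw [hM.out.add_zero, hM.out.mul_zero, hM.out.add_zero]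
  · rw [hM.out.add_succ, hM.out.mul_succ, hM.out.mul_succ, h, add_assoc]

theorem add_mul : (a + b) * c = a * c + b * c := by
  refine delta0_induction (fun c => (a + b) * c = a * c + b * c) ?_ (fun n h => ?_) c
  · simp only [hM.out.mul_zero, hM.out.add_zero]
  · rw [hM.out.mul_succ, hM.out.mul_succ, hM.out.mul_succ, h, add_assoc, add_assoc,
      ← add_assoc (b * n), ← add_assoc a, add_comm (b * n)]

theorem one_mul : 1 * a = a := by
  refine delta0_induction (fun a : M.Num => 1 * a = a) (hM.out.mul_zero 1) (fun n h => ?_) a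
  rw [hM.out.mul_succ, h]

theorem mul_comm : a * b = b * a := by
  refine delta0_induction (fun b => a * b = b * a) ?_ (fun n h => ?_) b
  · rw [hM.out.mul_zero, zero_mul]
  · rw [hM.out.mul_succ, h, add_mul, one_mul]

theorem mul_assoc : a * b * c = a * (b * c) := by
  refine delta0_induction (fun c => a * b * c = a * (b * c)) ?_ (fun n h => ?_) c
  · rw [hM.out.mul_zero, hM.out.mul_zero, hM.out.mul_zero]
  · rw [hM.out.mul_succ, hM.out.mul_succ, mul_add, h]

end Arith

/-- The operations are the ones of `M`, so the terms of the language are terms of the semiring. -/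
instance : CommSemiring M.Num where
  add_assoc := Arith.add_assoc
  zero_add := Arith.zero_add
  add_zero := hM.out.add_zero
  add_comm := Arith.add_comm
  left_distrib := Arith.mul_add
  right_distrib := Arith.add_mul
  zero_mul := Arith.zero_mul
  mul_zero := hM.out.mul_zero
  mul_assoc := Arith.mul_assoc
  one_mul := Arith.one_mul
  mul_one := Arith.mul_one
  mul_comm := Arith.mul_comm
  nsmul := nsmulRec
  npow := npowRec

namespace Arith

variable {a b c : M.Num}

theorem add_right_cancel : a + c = b + c → a = b := by
  refine delta0_induction (fun c => a + c = b + c → a = b) (by simp) (fun n h h' => ?_) c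
  exact h (hM.out.succ_inj _ _ (by rwa [← hM.out.add_succ, ← hM.out.add_succ]))

theorem lt_iff_exists : a < b ↔ ∃ r, a + (r + 1) = b := by
  constructor
  · intro h
    obtain ⟨r, hr⟩ := exists_induction (fun r b => a < b → a + (r + 1) = b)
      ⟨0, fun h => (hM.out.not_lt_zero _ h).elim⟩ (fun n ⟨r, hr⟩ => by
        by_cases h : a < n
        · exact ⟨r + 1, fun _ => by rw [← hr h]; ring⟩
        · refine ⟨0, fun h' => ?_⟩
          rcases (hM.out.lt_succ_iff _ _).1 h' with h' | rfl
          · exact (h h').elim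
          · ring) b
    exact ⟨r, hr h⟩
  · rintro ⟨r, rfl⟩
    refine delta0_induction (fun r => a < a + (r + 1)) ?_ (fun n h => ?_) r
    · rw [_root_.zero_add]
      exact (hM.out.lt_succ_iff _ _).2 (.inr rfl)
    · rw [hM.out.add_succ]
      exact (hM.out.lt_succ_iff _ _).2 (.inl h)

theorem eq_zero_or_eq_add_one (a : M.Num) : a = 0 ∨ ∃ b, a = b + 1 := by
  obtain ⟨b, h⟩ := exists_induction (fun b a : M.Num => a = 0 ∨ a = b + 1) ⟨0, .inl rfl⟩
    (fun n _ => ⟨n, .inr rfl⟩) a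
  exact h.imp_right fun h => ⟨b, h⟩

theorem lt_trichotomy (a b : M.Num) : a < b ∨ a = b ∨ b < a := by
  refine delta0_induction (fun b => a < b ∨ a = b ∨ b < a) ?_ (fun n h => ?_) b
  · rcases eq_zero_or_eq_add_one a with rfl | ⟨r, rfl⟩
    · exact .inr (.inl rfl)
    · exact .inr (.inr (lt_iff_exists.2 ⟨r, by ring⟩))
  · rcases h with h | rfl | h
    · exact .inl ((hM.out.lt_succ_iff _ _).2 (.inl h))
    · exact .inl ((hM.out.lt_succ_iff _ _).2 (.inr rfl))
    · obtain ⟨r, rfl⟩ := lt_iff_exists.1 h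
      rcases eq_zero_or_eq_add_one r with rfl | ⟨r, rfl⟩
      · exact .inr (.inl (by ring))
      · exact .inr (.inr (lt_iff_exists.2 ⟨r, by ring⟩))

theorem lt_irrefl (a : M.Num) : ¬ a < a := by
  intro h
  obtain ⟨r, hr⟩ := lt_iff_exists.1 h
  refine hM.out.succ_ne_zero r (add_right_cancel (c := a) ?_)
  rw [_root_.zero_add, _root_.add_comm, hr]

theorem lt_trans (h : a < b) (h' : b < c) : a < c := by
  obtain ⟨r, rfl⟩ := lt_iff_exists.1 h
  obtain ⟨s, rfl⟩ := lt_iff_exists.1 h'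
  exact lt_iff_exists.2 ⟨r + s + 1, by ring⟩

end Arith

/-- The strict order is the one of `M`, and `a ≤ b` is defined as `a < b ∨ a = b`. -/
noncomputable instance : LinearOrder M.Num where
  le a b := a < b ∨ a = b
  le_refl a := .inr rfl
  le_trans a b c := by
    rintro (h | rfl) (h' | rfl)
    · exact .inl (Arith.lt_trans h h')
    · exact .inl h
    · exact .inl h'
    · exact .inr rfl
  lt_iff_le_not_ge a b := by
    constructor
    · refine fun h => ⟨.inl h, ?_⟩
      rintro (h' | rfl)
      · exact Arith.lt_irrefl _ (Arith.lt_trans h h')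
      · exact Arith.lt_irrefl _ h
    · rintro ⟨h | rfl, h'⟩
      · exact h
      · exact (h' (.inr rfl)).elim
  le_antisymm a b := by
    rintro (h | rfl) (h' | h')
    · exact (Arith.lt_irrefl _ (Arith.lt_trans h h')).elim
    · exact h'.symm
    · rfl
    · rfl
  le_total a b := by
    rcases Arith.lt_trichotomy a b with h | h | h
    · exact .inl (.inl h)
    · exact .inl (.inr h)
    · exact .inr (.inl h)
  toDecidableLE := Classical.decRel _

theorem lt_add_one_iff {a b : M.Num} : a < b + 1 ↔ a ≤ b := hM.out.lt_succ_iff a b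

theorem lt_add_one_self (a : M.Num) : a < a + 1 := lt_add_one_iff.2 le_rfl

theorem add_one_le_iff {a b : M.Num} : a + 1 ≤ b ↔ a < b := by
  rw [← not_lt, lt_add_one_iff, not_le]

instance : CanonicallyOrderedAdd M.Num where
  exists_add_of_le {a b} := by
    rintro (h | rfl)
    · obtain ⟨r, rfl⟩ := Arith.lt_iff_exists.1 h
      exact ⟨r + 1, rfl⟩
    · exact ⟨0, (add_zero a).symm⟩
  le_add_self a b := by
    rcases Arith.eq_zero_or_eq_add_one b with rfl | ⟨r, rfl⟩
    · exact .inr (zero_add a).symm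
    · exact .inl (Arith.lt_iff_exists.2 ⟨r, add_comm _ _⟩)
  le_self_add a b := by
    rcases Arith.eq_zero_or_eq_add_one b with rfl | ⟨r, rfl⟩
    · exact .inr (add_zero a).symm
    · exact .inl (Arith.lt_iff_exists.2 ⟨r, rfl⟩)

instance : IsCancelAdd M.Num where
  add_left_cancel a b c h := Arith.add_right_cancel (c := a) (by simpa [add_comm] using h)
  add_right_cancel a b c h := Arith.add_right_cancel h

instance : IsStrictOrderedRing M.Num := by
  have h : ∀ a b c : M.Num, a ≤ b → a + c ≤ b + c := by
    rintro a b c h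
    obtain ⟨r, rfl⟩ := exists_add_of_le h
    rw [add_right_comm]
    exact le_self_add
  exact
  { add_le_add_left := fun a b h' c => h a b c h'
    le_of_add_le_add_left := fun a b c h' => by
      obtain ⟨r, hr⟩ := exists_add_of_le h'
      rw [add_assoc] at hr
      rw [add_left_cancel hr]
      exact le_self_add
    zero_le_one := zero_le
    exists_pair_ne := ⟨0, 1, fun h => hM.out.succ_ne_zero 0 (by rw [zero_add, ← h])⟩
    mul_lt_mul_of_pos_left := fun a ha b c h' => by
      obtain ⟨r, rfl⟩ := Arith.lt_iff_exists.1 h'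
      obtain ⟨s, rfl⟩ := Arith.lt_iff_exists.1 ha
      exact Arith.lt_iff_exists.2 ⟨r * (s + 1) + s, by ring⟩
    mul_lt_mul_of_pos_right := fun a ha b c h' => by
      obtain ⟨r, rfl⟩ := Arith.lt_iff_exists.1 h'
      obtain ⟨s, rfl⟩ := Arith.lt_iff_exists.1 ha
      exact Arith.lt_iff_exists.2 ⟨r * (s + 1) + s, by ring⟩ }

/-! ### Pairs and finite sequences -/

theorem pair_inj {a b c d : M.Num} : pair a b = pair c d ↔ a = c ∧ b = d := by
  refine ⟨fun h => ?_, by rintro ⟨rfl, rfl⟩; rfl⟩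
  -- `pair a b` lies between the squares of `a + b` and of `a + b + 1`, so it determines `a + b`.
  have key {a b c d : M.Num} (h : pair a b = pair c d) : ¬ a + b < c + d := by
    intro hlt
    obtain ⟨r, hr⟩ := Arith.lt_iff_exists.1 hlt
    unfold pair at h
    have : (a + b) * (a + b) + a < (c + d) * (c + d) + c := by
      rw [← hr, Arith.lt_iff_exists]
      exact ⟨b + (a + b) + (a + b) * r + (a + b) * r + r * r + r + r + c, by ring⟩
    exact this.ne h
  have hs : a + b = c + d := le_antisymm (not_lt.1 (key h.symm)) (not_lt.1 (key h))
  unfold pair at h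
  rw [hs] at h
  obtain rfl := add_left_cancel h
  exact ⟨rfl, add_left_cancel hs⟩

theorem le_mul_self (a : M.Num) : a ≤ a * a := by
  rcases Arith.eq_zero_or_eq_add_one a with rfl | ⟨r, rfl⟩
  · exact zero_le
  · calc r + 1 ≤ r + 1 + (r * r + r) := le_self_add
      _ = (r + 1) * (r + 1) := by ring

theorem left_le_pair (a b : M.Num) : a ≤ pair a b := le_add_self

theorem right_le_pair (a b : M.Num) : b ≤ pair a b :=
  (le_add_self.trans (le_mul_self (a + b))).trans le_self_add

theorem left_lt_pair_add_one (a b : M.Num) : a < pair a b + 1 :=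
  lt_add_one_iff.2 (left_le_pair a b)

theorem right_lt_pair_add_one (a b : M.Num) : b < pair a b + 1 :=
  lt_add_one_iff.2 (right_le_pair a b)

theorem lt_of_codedMem {x c : M.Num} (h : CodedMem x c) : x < c := by
  obtain ⟨b, d, e, rfl, hx, -⟩ := h
  exact hx.trans_le (left_le_pair _ _)

theorem lt_of_seqVal {s i a : M.Num} (h : SeqVal s i a) : a < s :=
  (right_le_pair i a).trans_lt (lt_of_codedMem h)

/-- All the witnesses in `CodedMem x c` are bounded by `c`. -/
theorem IsDelta0.codedMem_aux : IsDelta0 fun v : Fin 2 → M.Num => CodedMem (v 0) (v 1) := by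
  have : IsDelta0 fun v : Fin 2 → M.Num => ∃ b, b < v 1 + 1 ∧ ∃ d, d < v 1 + 1 ∧
      ∃ e, e < v 1 + 1 ∧ (v 1 = L2Structure.pair b (L2Structure.pair d e) ∧ v 0 < b ∧
        ∃ q, q < e + 1 ∧ e = q * (d * (v 0 + 1) + 1)) := inferInstance
  refine this.congr fun v => ?_
  constructor
  · rintro ⟨b, -, d, -, e, -, h, hb, q, -, hq⟩
    exact ⟨b, d, e, h, hb, q, hq⟩
  · rintro ⟨b, d, e, h, hb, q, hq⟩
    have hp : L2Structure.pair d e < v 1 + 1 := h ▸ right_lt_pair_add_one _ _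
    have hle : L2Structure.pair d e + 1 ≤ v 1 + 1 := add_one_le_iff.2 hp
    refine ⟨b, h ▸ left_lt_pair_add_one _ _, d, (left_lt_pair_add_one _ _).trans_le hle,
      e, (right_lt_pair_add_one _ _).trans_le hle, h, hb, q, ?_, hq⟩
    rw [lt_add_one_iff, hq]
    exact le_mul_of_one_le_right zero_le le_add_self

instance IsDelta0.codedMem (f g : (Fin n → M.Num) → M.Num) [IsTerm f] [IsTerm g] :
    IsDelta0 (fun v => CodedMem (f v) (g v)) :=
  codedMem_aux.comp₂ f g

instance IsDelta0.seqVal (f g h : (Fin n → M.Num) → M.Num) [IsTerm f] [IsTerm g]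
    [IsTerm h] : IsDelta0 (fun v => SeqVal (f v) (g v) (h v)) := by
  unfold SeqVal
  infer_instance

/-- The elements of a coded set and the entries of a coded sequence are bounded by the code. -/
theorem IsDelta0.isSeq_aux : IsDelta0 fun v : Fin 2 → M.Num => IsSeq (v 0) (v 1) := by
  have : IsDelta0 fun v : Fin 2 → M.Num => (∀ z, z < v 0 → CodedMem z (v 0) →
      ∃ i, i < v 1 ∧ ∃ a, a < z + 1 ∧ z = L2Structure.pair i a) ∧
      ∀ i, i < v 1 → ∃ a, a < v 0 ∧ SeqVal (v 0) i a ∧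
        ∀ b, b < v 0 → SeqVal (v 0) i b → b = a := inferInstance
  refine this.congr fun v => and_congr ⟨fun h z hz => ?_, fun h z _ hz => ?_⟩
    (forall₂_congr fun i hi => ⟨?_, ?_⟩)
  · obtain ⟨i, hi, a, -, h⟩ := h z (lt_of_codedMem hz) hz
    exact ⟨i, a, hi, h⟩
  · obtain ⟨i, a, hi, rfl⟩ := h z hz
    exact ⟨i, hi, a, right_lt_pair_add_one _ _, rfl⟩
  · rintro ⟨a, -, ha, h⟩
    exact ⟨a, ha, fun b hb => h b (lt_of_seqVal hb) hb⟩
  · rintro ⟨a, ha, h⟩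
    exact ⟨a, lt_of_seqVal ha, ha, fun b _ => h b⟩

instance IsDelta0.isSeq (f g : (Fin n → M.Num) → M.Num) [IsTerm f] [IsTerm g] :
    IsDelta0 (fun v => IsSeq (f v) (g v)) :=
  isSeq_aux.comp₂ f g

theorem IsSeq.lt_of_seqVal {s l i a : M.Num} (h : IsSeq s l) (hs : SeqVal s i a) : i < l := by
  obtain ⟨j, b, hj, h⟩ := h.1 _ hs
  rwa [(pair_inj.1 h).1]

theorem IsSeq.length_unique {s l l' : M.Num} (h : IsSeq s l) (h' : IsSeq s l') : l = l' := by
  have key {l l' : M.Num} (h : IsSeq s l) (h' : IsSeq s l') : l ≤ l' := by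
    by_contra! hlt
    obtain ⟨a, ha, -⟩ := h.2 l' hlt
    exact (h'.lt_of_seqVal ha).false
  exact le_antisymm (key h h') (key h' h)

/-! ### Coding of bounded sets -/

theorem dvd_of_dvd_add {m a b : M.Num} (hm : 0 < m) (ha : m ∣ a) (hab : m ∣ a + b) : m ∣ b := by
  obtain ⟨q, rfl⟩ := ha
  obtain ⟨q', h⟩ := hab
  have hq : q ≤ q' := by
    by_contra! hlt
    exact (mul_lt_mul_of_pos_left hlt hm).not_ge (h ▸ le_self_add)
  obtain ⟨r, rfl⟩ := exists_add_of_le hq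
  exact ⟨r, add_left_cancel (a := m * q) (by rw [h, mul_add])⟩

/-- `d (x + 1) + 1` is coprime to every divisor `r` of `d`, in the form in which it is used. -/
theorem dvd_of_dvd_mul_of_dvd {d x r e : M.Num} (hr : r ∣ d)
    (h : d * (x + 1) + 1 ∣ e * r) : d * (x + 1) + 1 ∣ e := by
  obtain ⟨q, hq⟩ := hr
  refine dvd_of_dvd_add (a := e * d * (x + 1)) (lt_add_one_iff.2 zero_le) ?_
    ⟨e, by ring⟩
  obtain ⟨t, ht⟩ := h
  exact ⟨t * q * (x + 1), by rw [hq, ← mul_assoc e, ht]; simp only [← hq]; ring⟩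

/-- Distinct moduli `d (x + 1) + 1` are coprime when `d` is a multiple of the difference of
their indices. -/
theorem dvd_of_dvd_mul_modulus {d x y e : M.Num} (hne : x ≠ y)
    (hd : ∀ r, x + r = y ∨ y + r = x → r ∣ d)
    (h : d * (x + 1) + 1 ∣ e * (d * (y + 1) + 1)) : d * (x + 1) + 1 ∣ e := by
  have hpos : 0 < d * (x + 1) + 1 := lt_add_one_iff.2 zero_le
  -- the difference of the moduli is `d r`, so the modulus of `x` divides `e d r`
  obtain ⟨r, hr, h⟩ : ∃ r, r ∣ d ∧ d * (x + 1) + 1 ∣ e * d * r := by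
    rcases le_total x y with hxy | hxy
    · obtain ⟨r, rfl⟩ := exists_add_of_le hxy
      refine ⟨r, hd r (.inl rfl), dvd_of_dvd_add hpos (a := e * (d * (x + 1) + 1))
        (dvd_mul_left _ _) ?_⟩
      convert h using 1
      ring
    · obtain ⟨r, rfl⟩ := exists_add_of_le hxy
      refine ⟨r, hd r (.inr rfl), dvd_of_dvd_add hpos (a := e * (d * (y + 1) + 1)) h ?_⟩
      exact ⟨e, by ring⟩
  exact dvd_of_dvd_mul_of_dvd dvd_rfl (dvd_of_dvd_mul_of_dvd hr h)

/-- A substitute for the factorial of `b`. -/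
theorem exists_pos_forall_lt_dvd (b : M.Num) : ∃ d, 0 < d ∧ ∀ y, y < b → y + 1 ∣ d := by
  have key := exists_induction
    (fun d b : M.Num => 0 < d ∧ ∀ y, y < b → ∃ q, q < d + 1 ∧ d = (y + 1) * q)
    ⟨1, lt_of_lt_of_eq (lt_add_one_iff.2 le_rfl) (zero_add 1),
      fun y hy => (not_lt_zero hy).elim⟩ ?_ b
  · obtain ⟨d, hd, h⟩ := key
    exact ⟨d, hd, fun y hy => let ⟨q, _, hq⟩ := h y hy; ⟨q, hq⟩⟩
  · rintro b ⟨d, hd, h⟩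
    refine ⟨d * (b + 1), mul_pos hd (lt_add_one_iff.2 zero_le), fun y hy => ?_⟩
    obtain ⟨q, hq⟩ : y + 1 ∣ d * (b + 1) := by
      rcases (lt_add_one_iff.1 hy).lt_or_eq with hy | rfl
      · obtain ⟨q, -, hq⟩ := h y hy
        exact dvd_mul_of_dvd_left ⟨q, hq⟩ _
      · exact dvd_mul_left _ _
    refine ⟨q, ?_, hq⟩
    rw [lt_add_one_iff, hq]
    exact le_mul_of_one_le_left zero_le le_add_self

/-- Bounded `Δ⁰₀` comprehension for finite sets coded by numbers. -/
theorem exists_code (p : M.Num → Prop) [hp : IsDelta0 (fun v : Fin 1 → M.Num => p (v 0))]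
    (b : M.Num) : ∃ c, ∀ x, CodedMem x c ↔ x < b ∧ p x := by
  obtain ⟨d, hd0, hd⟩ := exists_pos_forall_lt_dvd (M := M) b
  have : IsDelta0 (fun v : Fin 3 → M.Num => p (v 0)) := hp.comp₁ _
  have hone : (1 : M.Num) ≤ d := by rw [← zero_add 1]; exact add_one_le_iff.2 hd0
  have hbound {e q x : M.Num} (h : e = q * (d * (x + 1) + 1)) : q < e + 1 := by
    rw [lt_add_one_iff, h]
    exact le_mul_of_one_le_right zero_le le_add_self
  -- `e` collects the moduli of the elements below `n`
  have key := exists_induction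
    (fun e n : M.Num => ∀ x, x < b →
      ((∃ q, q < e + 1 ∧ e = q * (d * (x + 1) + 1)) ↔ (x < n ∧ p x))) ?_ ?_ b
  · obtain ⟨e, he⟩ := key
    refine ⟨pair b (pair d e), fun x => ⟨?_, fun h => ?_⟩⟩
    · rintro ⟨b', d', e', h, hx, q, hq⟩
      simp only [pair_inj] at h
      obtain ⟨rfl, rfl, rfl⟩ := h
      exact (he x hx).1 ⟨q, hbound hq, hq⟩
    · obtain ⟨q, -, hq⟩ := (he x h.1).2 h
      exact ⟨b, d, e, rfl, h.1, q, hq⟩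
  · refine ⟨1, fun x _ => ⟨fun ⟨q, _, hq⟩ => ?_, fun h => (not_lt_zero h.1).elim⟩⟩
    have hlt : 1 < d * (x + 1) + 1 := lt_add_one_iff.2 <| hone.trans <|
      le_mul_of_one_le_right zero_le le_add_self
    rcases Arith.eq_zero_or_eq_add_one q with rfl | ⟨r, rfl⟩
    · simp at hq
    · exact (hlt.trans_le (le_mul_of_one_le_left zero_le le_add_self)).ne hq |>.elim
  · rintro n ⟨e, he⟩
    by_cases hn : n < b ∧ p n
    · refine ⟨e * (d * (n + 1) + 1), fun x hx => ⟨fun ⟨q, _, hq⟩ => ?_, fun h => ?_⟩⟩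
      · by_cases hxn : x = n
        · rw [hxn]
          exact ⟨lt_add_one_iff.2 le_rfl, hn.2⟩
        · have hdvd : d * (x + 1) + 1 ∣ e := by
            refine dvd_of_dvd_mul_modulus hxn (fun r hr => ?_) ⟨q, hq.trans (mul_comm _ _)⟩
            rcases Arith.eq_zero_or_eq_add_one r with rfl | ⟨r, rfl⟩
            · exact (hxn (by simpa [eq_comm] using hr)).elim
            · refine hd r ?_
              have hr' : r < r + 1 := lt_add_one_iff.2 le_rfl
              rcases hr with rfl | rfl
              · exact (hr'.trans_le le_add_self).trans hn.1
              · exact (hr'.trans_le le_add_self).trans hx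
          obtain ⟨q, hq⟩ := hdvd
          rw [mul_comm] at hq
          have := (he x hx).1 ⟨q, hbound hq, hq⟩
          exact ⟨this.1.trans (lt_add_one_iff.2 le_rfl), this.2⟩
      · obtain ⟨q, hq⟩ : ∃ q, e * (d * (n + 1) + 1) = q * (d * (x + 1) + 1) := by
          rcases (lt_add_one_iff.1 h.1).lt_or_eq with hxn | rfl
          · obtain ⟨q, -, hq⟩ := (he x hx).2 ⟨hxn, h.2⟩
            exact ⟨q * (d * (n + 1) + 1), by rw [hq]; ring⟩
          · exact ⟨e, rfl⟩
        exact ⟨q, hbound hq, hq⟩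
    · refine ⟨e, fun x hx => (he x hx).trans (and_congr_left fun hpx => ?_)⟩
      rw [lt_add_one_iff, le_iff_lt_or_eq, or_iff_left]
      rintro rfl
      exact hn ⟨hx, hpx⟩

/-- A `Δ⁰₀` function has a code for each of its finite initial segments. -/
theorem exists_seq (p : M.Num → M.Num → Prop)
    [hp : IsDelta0 (fun v : Fin 2 → M.Num => p (v 0) (v 1))] (l : M.Num)
    (hl : ∀ i, i < l → ∃! a, p i a) :
    ∃ s, IsSeq s l ∧ ∀ i a, SeqVal s i a ↔ i < l ∧ p i a := by
  have (k : ℕ) (f g : (Fin k → M.Num) → M.Num) [IsTerm f] [IsTerm g] :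
      IsDelta0 (fun v => p (f v) (g v)) := hp.comp₂ f g
  -- a common bound for the pairs `(i, a)` with `i < l` and `p i a`, by `Σ⁰₁` induction
  obtain ⟨b, hb⟩ := exists_induction
    (fun b n : M.Num => ∀ i, i < n → (i < l → ∃ a, a < b ∧ (pair i a < b ∧ p i a)))
    ⟨0, fun i hi => (not_lt_zero hi).elim⟩ (by
      rintro n ⟨b, hb⟩
      by_cases hn : n < l
      · obtain ⟨a, ha, -⟩ := hl n hn
        refine ⟨b + (pair n a + 1), fun i hi hil => ?_⟩
        rcases (lt_add_one_iff.1 hi).lt_or_eq with hi | rfl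
        · obtain ⟨a', h1, h2, h3⟩ := hb i hi hil
          exact ⟨a', h1.trans_le le_self_add, h2.trans_le le_self_add, h3⟩
        · exact ⟨a, (right_lt_pair_add_one _ _).trans_le le_add_self,
            (lt_add_one_iff.2 le_rfl).trans_le le_add_self, ha⟩
      · refine ⟨b, fun i hi hil => hb i ?_ hil⟩
        exact (lt_add_one_iff.1 hi).lt_of_ne (by rintro rfl; exact hn hil)) l
  obtain ⟨s, hs⟩ := exists_code (fun z => ∃ i, i < l ∧ ∃ a, a < z + 1 ∧ (z = pair i a ∧ p i a)) b
  have hval (i a : M.Num) : SeqVal s i a ↔ i < l ∧ p i a := by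
    refine (hs _).trans ⟨?_, fun h => ?_⟩
    · rintro ⟨-, i', hi, a', -, h, hp⟩
      obtain ⟨rfl, rfl⟩ := pair_inj.1 h
      exact ⟨hi, hp⟩
    · obtain ⟨a', -, hlt, ha'⟩ := hb i h.1 h.1
      obtain rfl := (hl i h.1).unique h.2 ha'
      exact ⟨hlt, i, h.1, a, right_lt_pair_add_one _ _, rfl, h.2⟩
  refine ⟨s, ⟨fun z hz => ?_, fun i hi => ?_⟩, hval⟩
  · obtain ⟨-, i, hi, a, -, h, -⟩ := (hs z).1 hz
    exact ⟨i, a, hi, h⟩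
  · simpa [hval, hi] using hl i hi

/-- The least number principle for `Δ⁰₀` predicates. -/
theorem exists_least (p : M.Num → Prop) [hp : IsDelta0 (fun v : Fin 1 → M.Num => p (v 0))]
    (h : ∃ a, p a) : ∃ a, p a ∧ ∀ b, b < a → ¬ p b := by
  have : IsDelta0 (fun v : Fin 2 → M.Num => p (v 0)) := hp.comp₁ _
  by_contra! hcon
  obtain ⟨a, ha⟩ := h
  refine delta0_induction (fun n => ∀ b, b < n → ¬ p b) (fun b hb => (not_lt_zero hb).elim)
    (fun n hn b hb hpb => ?_) (a + 1) a (lt_add_one_iff.2 le_rfl) ha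
  obtain ⟨c, hc, hpc⟩ := hcon b hpb
  exact hn c (hc.trans_le (lt_add_one_iff.1 hb)) hpc

/-! ### Comprehension -/

/-- `Δ⁰₁` comprehension, for a predicate given by the `Δ⁰₀` matrices of its two definitions. -/
theorem delta01_comprehension_of_delta0 (p q : M.Num → M.Num → Prop)
    [hp : IsDelta0 fun v : Fin 2 → M.Num => p (v 0) (v 1)]
    [hq : IsDelta0 fun v : Fin 2 → M.Num => q (v 0) (v 1)]
    (h : ∀ z, (∃ s, p s z) ↔ ∀ s, q s z) : {z | ∃ s, p s z} ∈ M.sets := by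
  refine hM.out.delta01_comprehension _ (isSigma01_of_isDelta0 p) ?_
  obtain ⟨φ, hφ⟩ := hq
  exact ⟨φ, fun z => by simp [hφ, h]⟩

theorem setOf_mem_sets (p : M.Num → Prop) [hp : IsDelta0 fun v : Fin 1 → M.Num => p (v 0)] :
    {z | p z} ∈ M.sets := by
  have : IsDelta0 fun v : Fin 2 → M.Num => p (v 1) := hp.comp₁ _
  have key := delta01_comprehension_of_delta0 (fun _ z => p z) (fun _ z => p z)
    fun z => ⟨fun ⟨_, h⟩ _ => h, fun h => ⟨0, h 0⟩⟩
  simpa using key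

theorem exists_relation (p : M.Num → M.Num → Prop)
    [hp : IsDelta0 fun v : Fin 2 → M.Num => p (v 0) (v 1)] :
    ∃ X ∈ M.sets, ∀ x y, pair x y ∈ X ↔ p x y := by
  have (k : ℕ) (f g : (Fin k → M.Num) → M.Num) [IsTerm f] [IsTerm g] :
      IsDelta0 (fun v => p (f v) (g v)) := hp.comp₂ f g
  refine ⟨_, setOf_mem_sets fun z => ∃ x, x < z + 1 ∧ ∃ y, y < z + 1 ∧ (z = pair x y ∧ p x y),
    fun x y => ⟨?_, fun h => ?_⟩⟩
  · rintro ⟨x', -, y', -, h, hp⟩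
    obtain ⟨rfl, rfl⟩ := pair_inj.1 h
    exact hp
  · exact ⟨x, left_lt_pair_add_one _ _, y, right_lt_pair_add_one _ _, rfl, h⟩

/-- Comprehension for a relation between `x` and `y` that is `Δ⁰₀` in `x`, `y` and the value of a
function of `M` at a term in `x`. -/
theorem exists_relation_of_value {F : Set M.Num} {f : M.Num → M.Num} (hF : F ∈ M.sets)
    (hf : ∀ n a, pair n a ∈ F ↔ a = f n) (t : M.Num → M.Num)
    (ht : IsTerm fun v : Fin 1 → M.Num => t (v 0)) (p : M.Num → M.Num → M.Num → Prop)
    [hp : IsDelta0 fun v : Fin 3 → M.Num => p (v 0) (v 1) (v 2)] :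
    ∃ X ∈ M.sets, ∀ x y, pair x y ∈ X ↔ p x y (f (t x)) := by
  have (k : ℕ) (g : (Fin k → M.Num) → M.Num) [hg : IsTerm g] : IsTerm fun v => t (g v) :=
    ht.comp (fun _ => g) fun _ => hg
  have (k : ℕ) (g₁ g₂ g₃ : (Fin k → M.Num) → M.Num) [IsTerm g₁] [IsTerm g₂] [IsTerm g₃] :
      IsDelta0 (fun v => p (g₁ v) (g₂ v) (g₃ v)) := hp.comp₃ g₁ g₂ g₃
  have : Fact (F ∈ M.sets) := ⟨hF⟩
  refine ⟨_, delta01_comprehension_of_delta0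
    (fun s z => ∃ x, x < z + 1 ∧ ∃ y, y < z + 1 ∧ (z = pair x y ∧ pair (t x) s ∈ F ∧ p x y s))
    (fun s z => (∃ x, x < z + 1 ∧ ∃ y, y < z + 1 ∧ z = pair x y) ∧
      ∀ x, x < z + 1 → ∀ y, y < z + 1 → (z = pair x y → pair (t x) s ∈ F → p x y s))
    fun z => ⟨?_, fun h => ?_⟩, fun x y => ⟨?_, fun h => ?_⟩⟩
  · rintro ⟨s, x, hx, y, hy, rfl, hs, h⟩ s'
    refine ⟨⟨x, hx, y, hy, rfl⟩, fun x' _ y' _ h' hs' => ?_⟩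
    obtain ⟨rfl, rfl⟩ := pair_inj.1 h'
    rw [hf] at hs hs'
    rwa [hs', ← hs]
  · obtain ⟨x, hx, y, hy, rfl⟩ := (h 0).1
    have hs := (hf (t x) _).2 rfl
    exact ⟨f (t x), x, hx, y, hy, rfl, hs, (h _).2 x hx y hy rfl hs⟩
  · rintro ⟨s, x', -, y', -, h, hs, hp⟩
    obtain ⟨rfl, rfl⟩ := pair_inj.1 h
    rw [hf] at hs
    exact hs ▸ hp
  · exact ⟨f (t x), x, left_lt_pair_add_one _ _, y, right_lt_pair_add_one _ _, rfl,
      (hf _ _).2 rfl, h⟩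

/-! ### The three implications -/

theorem wrt_of_terminationTheorem {k : M.Num} (h : M.TerminationTheorem k) : M.WRT k := by
  rintro P ⟨hP, hcol⟩
  have : Fact (P ∈ M.sets) := ⟨hP⟩
  by_contra hcon
  obtain ⟨R, hR, hRmem⟩ := exists_relation (fun x y : M.Num => x = y + 1)
  obtain ⟨X, hX, hXmem⟩ := exists_relation (fun i z : M.Num =>
    ∃ x, x < z + 1 ∧ ∃ y, y < z + 1 ∧ (z = pair x y ∧ y < x ∧ pair (pair y x) i ∈ P))
  have hXmem' (i x y : M.Num) : RelAt X i x y ↔ y < x ∧ pair (pair y x) i ∈ P := by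
    refine (hXmem _ _).trans ⟨?_, fun h => ?_⟩
    · rintro ⟨x', -, y', -, h, h'⟩
      obtain ⟨rfl, rfl⟩ := pair_inj.1 h
      exact h'
    · exact ⟨x, left_lt_pair_add_one _ _, y, right_lt_pair_add_one _ _, rfl, h⟩
  refine h R hR X hX (fun c hc => ?_) (fun x y hxy => ?_) ?_
  · -- the range of an `X_c`-descending sequence is weakly homogeneous of colour `c`
    rintro ⟨F, hF, hdesc⟩
    obtain ⟨f, hf⟩ := hF.exists_eq
    have : Fact (F ∈ M.sets) := ⟨hF.1⟩
    have hstep (n : M.Num) : f n < f (n + 1) ∧ pair (pair (f n) (f (n + 1))) c ∈ P :=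
      (hXmem' _ _ _).1 (hdesc n _ _ ((hf _ _).2 rfl) ((hf _ _).2 rfl))
    have hge (n : M.Num) : n ≤ f n := by
      obtain ⟨a, ha, h⟩ := exists_induction (fun a n : M.Num => pair n a ∈ F ∧ n < a + 1)
        ⟨f 0, (hf _ _).2 rfl, lt_add_one_iff.2 zero_le⟩ (fun n ⟨a, ha, h⟩ => by
          rw [hf] at ha
          rw [lt_add_one_iff, ha] at h
          exact ⟨f (n + 1), (hf _ _).2 rfl,
            lt_add_one_iff.2 (add_one_le_iff.2 (h.trans_lt (hstep n).1))⟩) n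
      rw [hf] at ha
      rwa [lt_add_one_iff, ha] at h
    refine hcon ⟨c, hc, _, setOf_mem_sets (fun a => ∃ i, i < a + 1 ∧ pair i a ∈ F),
      fun n => ?_, F, hF, fun a => ⟨?_, ?_⟩, fun i a b ha hb => ?_⟩
    · exact ⟨f (n + 1), (lt_add_one_self n).trans_le (hge _), n + 1, lt_add_one_iff.2 (hge _),
        (hf _ _).2 rfl⟩
    · rintro ⟨i, -, hi⟩
      exact ⟨i, hi⟩
    · rintro ⟨i, hi⟩
      refine ⟨i, ?_, hi⟩
      rw [hf] at hi
      rw [hi, lt_add_one_iff]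
      exact hge i
    · rw [hf] at ha hb
      rw [ha, hb]
      exact hstep i
  · obtain ⟨s, l, hl, hs, hx, hy, hstep⟩ := hxy
    -- `R` lowers its argument by one, so the entry at place `i` is `x - i`
    have key := delta0_induction
      (fun i : M.Num => i < l + 1 → ∃ a, a < s ∧ (SeqVal s i a ∧ a + i = x))
      (fun _ => ⟨x, lt_of_seqVal hx, hx, add_zero x⟩) (fun i hi hil => by
        have hil' : i < l := lt_of_add_lt_add_right hil
        obtain ⟨a, -, ha, hax⟩ := hi (hil'.trans (lt_add_one_self l))
        obtain ⟨b, hb, -⟩ := hs.2 _ hil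
        obtain rfl := (hRmem _ _).1 (hstep i a b hil' ha hb)
        exact ⟨b, lt_of_seqVal hb, hb, by rw [← hax]; ring⟩) l (lt_add_one_self l)
    obtain ⟨a, -, ha, rfl⟩ := key
    obtain rfl := (hs.2 l (lt_add_one_self l)).unique ha hy
    have hlt : a < a + l := lt_add_of_pos_right a hl
    obtain ⟨⟨c, hc, -⟩, hck⟩ := hcol _ _ hlt
    exact ⟨c, hck c hc, (hXmem' _ _ _).2 ⟨hlt, hc⟩⟩
  · obtain ⟨I, hI, hImem⟩ := exists_relation (fun x y : M.Num => y = x)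
    refine ⟨I, ⟨hI, fun n => ⟨n, (hImem _ _).2 rfl, fun a => (hImem _ _).1⟩⟩,
      fun n a b ha hb => ?_⟩
    rw [hImem] at ha hb
    rw [ha, hb]
    exact (hRmem _ _).2 rfl

theorem weakHClosure_of_wrt {k : M.Num} (h : M.WRT k) : M.WeakHClosure k := by
  rintro X hX hWF ⟨F, hF, hdesc⟩
  obtain ⟨f, hf⟩ := hF.exists_eq
  have : Fact (X ∈ M.sets) := ⟨hX⟩
  have : Fact (F ∈ M.sets) := ⟨hF.1⟩
  have hFf (n : M.Num) : pair n (f n) ∈ F := (hf _ _).2 rfl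
  have hInH (n : M.Num) : InH (UnionRel X k) (f n) := (hdesc n _ _ (hFf n) (hFf _)).2.1
  have hext (n : M.Num) : OneStepExt (f (n + 1)) (f n) := (hdesc n _ _ (hFf n) (hFf _)).2.2
  obtain ⟨l, hl, -⟩ := hInH 0
  have hlen (n : M.Num) : IsSeq (f n) (l + n) := by
    obtain ⟨s, hs, h⟩ := exists_induction (fun s n : M.Num => pair n s ∈ F ∧ IsSeq s (l + n))
      ⟨f 0, hFf 0, by rwa [add_zero]⟩ (fun n ⟨s, hs, h⟩ => by
        obtain rfl := (hf _ _).1 hs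
        obtain ⟨l', h1, h2, -⟩ := hext n
        obtain rfl := h.length_unique h1
        exact ⟨_, hFf _, by rwa [← add_assoc]⟩) n
    obtain rfl := (hf _ _).1 hs
    exact h
  have hagree {n i a : M.Num} (hi : i < l + n) (r : M.Num) :
      SeqVal (f (n + r)) i a ↔ SeqVal (f n) i a := by
    obtain ⟨s, hs, h⟩ := exists_induction
      (fun s r : M.Num => pair (n + r) s ∈ F ∧ (SeqVal s i a ↔ SeqVal (f n) i a))
      ⟨f n, by simpa using hFf n, Iff.rfl⟩ (fun r ⟨s, hs, h⟩ => by
        obtain rfl := (hf _ _).1 hs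
        refine ⟨_, hFf _, .trans ?_ h⟩
        obtain ⟨l', h1, -, h3⟩ := hext (n + r)
        obtain rfl := (hlen _).length_unique h1
        rw [← add_assoc]
        exact h3 i a (hi.trans_le (by rw [← add_assoc]; exact le_self_add))) r
    obtain rfl := (hf _ _).1 hs
    exact h
  have hagree' {i j a : M.Num} (hij : i ≤ j) :
      SeqVal (f (j + 1)) i a ↔ SeqVal (f (i + 1)) i a := by
    obtain ⟨r, rfl⟩ := exists_add_of_le hij
    rw [add_right_comm]
    exact hagree ((lt_add_one_self i).trans_le le_add_self) r
  -- `g` is the union of the sequences `f n`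
  have hex (i : M.Num) : ∃! a, SeqVal (f (i + 1)) i a :=
    (hlen (i + 1)).2 i ((lt_add_one_self i).trans_le le_add_self)
  choose g hg hg' using hex
  have hval {i j a : M.Num} (hij : i ≤ j) : SeqVal (f (j + 1)) i a ↔ a = g i :=
    (hagree' hij).trans ⟨hg' i a, by rintro rfl; exact hg i⟩
  have hgdesc {i j : M.Num} (hij : i < j) : UnionRel X k (g j) (g i) := by
    obtain ⟨l', hl', h⟩ := hInH (j + 1)
    obtain rfl := (hlen _).length_unique hl'
    exact h i j _ _ hij ((lt_add_one_self j).trans_le le_add_self)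
      ((hval hij.le).2 rfl) ((hval le_rfl).2 rfl)
  obtain ⟨G, hG, hGmem⟩ := exists_relation_of_value hF.1 hf (fun x => x + 1) (by infer_instance)
    (fun n a s => SeqVal s n a)
  replace hGmem (n a : M.Num) : pair n a ∈ G ↔ a = g n := (hGmem n a).trans (hval le_rfl)
  have : Fact (G ∈ M.sets) := ⟨hG⟩
  -- The colour of `(i, j)` is the least `c` with `g j X_c g i`; both values are read off `f (z + 1)`
  -- for the code `z ≥ i, j` of the pair.
  obtain ⟨P, hP, hPmem⟩ := exists_relation_of_value hF.1 hf (fun x => x + 1) (by infer_instance)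
    (fun z c s => c < k ∧ ∃ i, i < z + 1 ∧ ∃ j, j < z + 1 ∧ (z = pair i j ∧
      ∃ a, a < s ∧ (SeqVal s i a ∧ ∃ b, b < s ∧ (SeqVal s j b ∧
        pair c (pair b a) ∈ X ∧ ∀ d, d < c → ¬ pair d (pair b a) ∈ X))))
  replace hPmem (i j c : M.Num) : pair (pair i j) c ∈ P ↔
      c < k ∧ RelAt X c (g j) (g i) ∧ ∀ d, d < c → ¬ RelAt X d (g j) (g i) := by
    rw [hPmem]
    refine and_congr_right fun _ => ⟨?_, fun h => ?_⟩
    · rintro ⟨i', -, j', -, hz, a, -, ha, b, -, hb, h⟩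
      obtain ⟨rfl, rfl⟩ := pair_inj.1 hz
      rw [hval (left_le_pair _ _)] at ha
      rw [hval (right_le_pair _ _)] at hb
      rwa [ha, hb] at h
    · have ha := (hval (left_le_pair i j)).2 rfl
      have hb := (hval (right_le_pair i j)).2 rfl
      exact ⟨i, left_lt_pair_add_one _ _, j, right_lt_pair_add_one _ _, rfl,
        g i, lt_of_seqVal ha, ha, g j, lt_of_seqVal hb, hb, h⟩
  obtain ⟨c, hc, H, -, -, E, hE, -, hEP⟩ := h P ⟨hP, fun i j hij => by
    refine ⟨?_, fun c hc => ((hPmem _ _ _).1 hc).1⟩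
    obtain ⟨c, ⟨hck, hc⟩, hmin⟩ := exists_least
      (fun c => c < k ∧ pair c (pair (g j) (g i)) ∈ X) (hgdesc hij)
    have hmin' (d : M.Num) (hd : d < c) : ¬ RelAt X d (g j) (g i) :=
      fun h => hmin d hd ⟨hd.trans hck, h⟩
    refine ⟨c, (hPmem _ _ _).2 ⟨hck, hc, hmin'⟩, fun d hd => ?_⟩
    obtain ⟨-, hd, hdmin⟩ := (hPmem _ _ _).1 hd
    exact le_antisymm (not_lt.1 fun h => hdmin c h hc) (not_lt.1 fun h => hmin' d h hd)⟩
  obtain ⟨e, he⟩ := hE.exists_eq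
  obtain ⟨D, hD, hDmem⟩ := exists_relation_of_value hE.1 he (fun x => x) inferInstance
    (fun _ a s => pair s a ∈ G)
  simp only [hGmem] at hDmem
  refine hWF c hc ⟨D, ⟨hD, fun n => ⟨g (e n), (hDmem _ _).2 rfl, fun a => (hDmem _ _).1⟩⟩,
    fun n a b ha hb => ?_⟩
  rw [hDmem] at ha hb
  rw [ha, hb]
  exact ((hPmem _ _ _).1 (hEP n _ _ ((he _ _).2 rfl) ((he _ _).2 rfl)).2).2.1

theorem terminationTheorem_of_weakHClosure {k : M.Num} (h : M.WeakHClosure k) :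
    M.TerminationTheorem k := by
  rintro R hR X hX hWF hsub ⟨F, hF, hdesc⟩
  obtain ⟨f, hf⟩ := hF.exists_eq
  have : Fact (F ∈ M.sets) := ⟨hF.1⟩
  have hstep (n : M.Num) : Rel R (f (n + 1)) (f n) :=
    hdesc n _ _ ((hf _ _).2 rfl) ((hf _ _).2 rfl)
  -- the reversed segment `f j, …, f i` witnesses that `(f j, f i)` is in the transitive closure
  have htrans {i j : M.Num} (hij : i < j) : TransClosure (Rel R) (f j) (f i) := by
    obtain ⟨r, rfl⟩ := Arith.lt_iff_exists.1 hij
    obtain ⟨s, hs, hval⟩ := exists_seq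
      (fun t a => ∃ u, u < i + (r + 1) + 1 ∧ (t + u = i + (r + 1) ∧ pair u a ∈ F)) (r + 1 + 1)
      (fun t ht => by
        obtain ⟨u, hu⟩ := exists_add_of_le (lt_add_one_iff.1 ht)
        have hu' : t + (i + u) = i + (r + 1) := by rw [hu]; ring
        refine ⟨f (i + u), ⟨i + u, ?_, hu', (hf _ _).2 rfl⟩, ?_⟩
        · rw [lt_add_one_iff, ← hu']
          exact le_add_self
        · rintro a ⟨u', -, h, ha⟩
          rw [(hf _ _).1 ha, add_left_cancel (h.trans hu'.symm)])
    have hval' {t u : M.Num} (ht : t < r + 1 + 1) (hu : t + u = i + (r + 1)) :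
        SeqVal s t (f u) := by
      refine (hval _ _).2 ⟨ht, u, ?_, hu, (hf _ _).2 rfl⟩
      rw [lt_add_one_iff, ← hu]
      exact le_add_self
    refine ⟨s, r + 1, lt_add_one_iff.2 zero_le, hs, hval' (lt_add_one_iff.2 zero_le) (zero_add _),
      hval' (lt_add_one_self _) (add_comm _ _), fun t a b ht ha hb => ?_⟩
    obtain ⟨-, u, -, hu, ha⟩ := (hval _ _).1 ha
    obtain ⟨-, w, -, hw, hb⟩ := (hval _ _).1 hb
    obtain rfl : u = w + 1 := by
      refine add_left_cancel (a := t) ?_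
      rw [hu, ← hw]
      ring
    rw [(hf _ _).1 ha, (hf _ _).1 hb]
    exact hstep w
  -- `C n s`: the number `s` codes `f 0, …, f (n - 1)`
  let C (n s : M.Num) : Prop := IsSeq s n ∧ ∀ i, i < n → ∃ a, a < s ∧ (SeqVal s i a ∧ pair i a ∈ F)
  have hCdef (m : ℕ) (t₁ t₂ : (Fin m → M.Num) → M.Num) [h₁ : IsTerm t₁] [h₂ : IsTerm t₂] :
      IsDelta0 fun v => C (t₁ v) (t₂ v) := by
    have : IsDelta0 fun v : Fin 2 → M.Num => C (v 0) (v 1) := by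
      unfold C
      infer_instance
    exact this.comp₂ t₁ t₂
  have hCex (n : M.Num) : ∃ s, C n s := by
    obtain ⟨s, hs, hval⟩ := exists_seq (fun i a => pair i a ∈ F) n fun i _ => hF.2 i
    refine ⟨s, hs, fun i hi => ?_⟩
    have := (hval i (f i)).2 ⟨hi, (hf _ _).2 rfl⟩
    exact ⟨f i, lt_of_seqVal this, this, (hf _ _).2 rfl⟩
  have hCval {n s i a : M.Num} (hC : C n s) (hi : i < n) : SeqVal s i a ↔ a = f i := by
    obtain ⟨b, -, hb, hbF⟩ := hC.2 i hi
    obtain rfl := (hf _ _).1 hbF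
    exact ⟨fun ha => (hC.1.2 i hi).unique ha hb, by rintro rfl; exact hb⟩
  have hCH {n s : M.Num} (hC : C n s) : InH (UnionRel X k) s := by
    refine ⟨n, hC.1, fun i j a b hij hj ha hb => ?_⟩
    rw [hCval hC (hij.trans hj)] at ha
    rw [hCval hC hj] at hb
    rw [ha, hb]
    exact hsub _ _ (htrans hij)
  -- A sequence has several codes; the least one gives a definable choice.
  obtain ⟨G, hG, hGmem⟩ := exists_relation (fun n s : M.Num => C n s ∧ ∀ t, t < s → ¬ C n t)
  refine h X hX hWF ⟨G, ⟨hG, fun n => ?_⟩, fun n s t hs ht => ?_⟩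
  · obtain ⟨s, hs, hmin⟩ := exists_least (C n) (hCex n)
    refine ⟨s, (hGmem _ _).2 ⟨hs, hmin⟩, fun t ht => ?_⟩
    obtain ⟨ht, htmin⟩ := (hGmem _ _).1 ht
    exact le_antisymm (not_lt.1 fun h => htmin s h hs) (not_lt.1 fun h => hmin t h ht)
  · replace hs := ((hGmem _ _).1 hs).1
    replace ht := ((hGmem _ _).1 ht).1
    refine ⟨hCH ht, hCH hs, n, hs.1, ht.1, fun i a hi => ?_⟩
    rw [hCval hs hi, hCval ht (hi.trans (lt_add_one_self n))]

end L2Structure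

theorem mainTheorem2 (M : L2Structure.{u}) (hM : M.IsModelRCA0) (k : M.Num) :
    List.TFAE [M.TerminationTheorem k, M.WRT k, M.WeakHClosure k] := by
  have : Fact M.IsModelRCA0 := ⟨hM⟩
  tfae_have 1 → 2 := L2Structure.wrt_of_terminationTheorem
  tfae_have 2 → 3 := L2Structure.weakHClosure_of_wrt
  tfae_have 3 → 1 := L2Structure.terminationTheorem_of_weakHClosure
  tfae_finish
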